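/- Let $n\ge 1$ and $|\rho|\le 1$, and put $\Sigma_\rho=\begin{bmatrix}1&\rho\\ \rho&1\end{bmatrix}$. Given a pair $(X,Y)\in\mathbb{R}^n\times\mathbb{R}^n$ of random sequences, consider the hypothesis testing problem $$\mathcal H_0:\ (X_1,Y_1),\dots,(X_n,Y_n)\ \overset{\text{i.i.d.}}{\sim}\ \mathcal N(0,\Sigma_0),\qquad \mathcal H_1:\ (X_1,Y_{\sigma(1)}),\dots,(X_n,Y_{\sigma(n)})\ \overset{\text{i.i.d.}}{\sim}\ \mathcal N(0,\Sigma_\rho)\ \text{ given }\sigma,$$ where $\sigma$ is a uniformly random permutation of $\{1,\dots,n\}$. Let $\mathbb P_{\mathcal H_0}$ and $\mathbb P_{\mathcal H_1}$ be the laws of $(X,Y)$ under the two hypotheses (so $\mathbb P_{\mathcal H_1}$ is averaged over $\sigma$), and let $$\mathsf R^\star=\mathsf R^\star(\rho,n)=\inf_{\phi}\big(\mathbb P_{\mathcal H_0}[\phi(X,Y)=1]+\mathbb P_{\mathcal H_1}[\phi(X,Y)=0]\big)$$ be the optimal risk, the infimum being over all measurable tests $\phi:\mathbb R^n\times\mathbb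 R^n\to\{0,1\}$. A sequence $(\rho_k,n_k)_k$ is called admissible for weak detection if $\limsup_{k\to\infty}\mathsf R^\star(\rho_k,n_k)<1$. **Theorem (impossibility of weak detection).** For every sequence $(\rho_k,n_k)_{k}$ with $|\rho_k|\le 1$ and $\rho_k^2\to 0$ as $k\to\infty$ (no condition being imposed on the positive integers $n_k$), $$\lim_{k\to\infty}\mathsf R^\star(\rho_k,n_k)=1 .$$ In particular, $(\rho_k,n_k)_k$ is not admissible for weak detection. -/

import Mathlib

open Filter Topology MeasureTheory ProbabilityTheory

namespace DatabaseDetection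

noncomputable section

/-- The covariance matrix `Σ_ρ` with unit diagonal and off-diagonal entries `ρ`. -/
def corrMatrix (ρ : ℝ) : Matrix (Fin 2) (Fin 2) ℝ := !![1, ρ; ρ, 1]

/-- The sample space of `(X, Y)`: pairs of real sequences of length `n`. -/
abbrev Obs (n : ℕ) : Type := (Fin n → ℝ) × (Fin n → ℝ)

/-- Turns pairs `w 0, w 1, …` into the observation `(X, Y)` with `(X i, Y (σ i)) = w i`
for all `i`. -/
def toObs {n : ℕ} (σ : Equiv.Perm (Fin n)) (w : Fin n → EuclideanSpace ℝ (Fin 2)) : Obs n :=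
  (fun i => w i 0, fun j => w (σ.symm j) 1)

/-- The law of `(X, Y)` when the pairs `(X i, Y (σ i))` are i.i.d. centred Gaussian vectors with
covariance matrix `Σ_ρ`. -/
def plantedLaw (ρ : ℝ) (n : ℕ) (σ : Equiv.Perm (Fin n)) : Measure (Obs n) :=
  (Measure.pi fun _ : Fin n => multivariateGaussian 0 (corrMatrix ρ)).map (toObs σ)

/-- The law of `(X, Y)` under the null hypothesis: the pairs `(X i, Y i)` are i.i.d. centred
Gaussian vectors with covariance matrix `Σ_0`. -/
def nullLaw (n : ℕ) : Measure (Obs n) :=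
  (Measure.pi fun _ : Fin n => multivariateGaussian 0 (corrMatrix 0)).map (toObs 1)

/-- The law of `(X, Y)` under the alternative hypothesis: the average of the planted laws over a
uniformly random permutation. -/
def altLaw (ρ : ℝ) (n : ℕ) : Measure (Obs n) :=
  (Fintype.card (Equiv.Perm (Fin n)) : ENNReal)⁻¹ • ∑ σ : Equiv.Perm (Fin n), plantedLaw ρ n σ

/-- The risk of a test: the sum of its Type-I and Type-II error probabilities. -/
def risk (ρ : ℝ) (n : ℕ) (φ : Obs n → Fin 2) : ℝ :=
  (nullLaw n).real {z | φ z = 1} + (altLaw ρ n).real {z | φ z = 0}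

/-- The optimal risk `R*`: the infimum of the risk over all (measurable) tests. -/
def optRisk (ρ : ℝ) (n : ℕ) : ℝ :=
  ⨅ φ : {φ : Obs n → Fin 2 // Measurable φ}, risk ρ n φ

/-- The sequence `(ρ_k, n_k)` is admissible for weak detection. -/
def AdmissibleWeak (ρ : ℕ → ℝ) (n : ℕ → ℕ) : Prop :=
  limsup (fun k => optRisk (ρ k) (n k)) atTop < 1

end

end DatabaseDetection

/-!
The second moment method. With respect to the null law, the law planted by a permutation `σ` has
likelihood ratio `L_σ`. The product of `L_σ` and `L_τ` with the null density is, after shearing, a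
Gaussian density in a linear image of `(X, Y)`, so its integral is a Jacobian:
`E₀[L_σ L_τ] = 1 / det (1 - ρ² P_π)` with `π = σ⁻¹ τ`. Averaged over `π` this is the Molien series
of the symmetric group, whose invariant ring is generated in degrees `1, …, n`:
`E₀[L²] = (1 / n!) ∑ π, 1 / det (1 - ρ² P_π) = ∏_{k = 1}^n 1 / (1 - ρ^(2k))`.
The product is at most `1 / (1 - ρ² / (1 - ρ²))` for small `ρ`, whatever `n` is, and by
Cauchy–Schwarz `R* ≥ 1 - √(E₀[L²] - 1) / 2`.

Molien's series is evaluated by removing points from permutations one at a time: with a separate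
weight for each point, deleting a point from its cycle multiplies its weight into its predecessor.
-/

namespace DatabaseDetection

noncomputable section

section PermutationDeterminant

variable {R : Type*} [CommRing R]

lemma det_eq_mul_det_submatrix_succ {n : ℕ} (A : Matrix (Fin (n + 1)) (Fin (n + 1)) R)
    (hA : ∀ i : Fin n, A i.succ 0 = 0) :
    A.det = A 0 0 * (A.submatrix Fin.succ Fin.succ).det := by
  simp [Matrix.det_succ_column_zero, Fin.sum_univ_succ, hA]

/-- The matrix `1 - D P_π`, where `D` is diagonal with entries `w` and `P_π` is the matrix of `π`.
Its determinant is the product over the cycles of `π` of one minus the product of the weights along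
the cycle; non-constant weights are what allows a point to be removed from its cycle. -/
def oneSubWeightedPerm {ι : Type*} [Fintype ι] [DecidableEq ι] (w : ι → R) (π : Equiv.Perm ι) :
    Matrix ι ι R :=
  1 - Matrix.diagonal w * π.permMatrix R

section

variable {ι : Type*} [Fintype ι] [DecidableEq ι]

lemma oneSubWeightedPerm_apply (w : ι → R) (π : Equiv.Perm ι) (i j : ι) :
    oneSubWeightedPerm w π i j = (if i = j then 1 else 0) - if π i = j then w i else 0 := by
  simp [oneSubWeightedPerm, Matrix.one_apply, Equiv.Perm.permMatrix, PEquiv.toMatrix_apply,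
    eq_comm]

lemma oneSubWeightedPerm_const (q : R) (π : Equiv.Perm ι) :
    oneSubWeightedPerm (fun _ => q) π = 1 - q • π.permMatrix R := by
  rw [oneSubWeightedPerm, Matrix.smul_eq_diagonal_mul]

lemma det_oneSubWeightedPerm_comp (w : ι → R) (π τ : Equiv.Perm ι) :
    (oneSubWeightedPerm (w ∘ τ) π).det = (oneSubWeightedPerm w (τ * π * τ⁻¹)).det := by
  rw [← Matrix.det_submatrix_equiv_self τ (oneSubWeightedPerm w _)]
  congr 1
  ext i j
  simp [oneSubWeightedPerm_apply]

end

lemma det_oneSubWeightedPerm_decomposeFin_zero {n : ℕ} (x : R) (w : Fin n → R)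
    (e : Equiv.Perm (Fin n)) :
    (oneSubWeightedPerm (Fin.cons x w) (Equiv.Perm.decomposeFin.symm (0, e))).det =
      (1 - x) * (oneSubWeightedPerm w e).det := by
  rw [det_eq_mul_det_submatrix_succ _ fun i => by
    simp [oneSubWeightedPerm_apply, Fin.succ_ne_zero]]
  congr 2
  · simp [oneSubWeightedPerm_apply]
  · ext i j
    simp [oneSubWeightedPerm_apply]

lemma det_oneSubWeightedPerm_decomposeFin_succ {n : ℕ} (x : R) (w : Fin n → R)
    (e : Equiv.Perm (Fin n)) (i : Fin n) :
    (oneSubWeightedPerm (Fin.cons x w) (Equiv.Perm.decomposeFin.symm ((e i).succ, e))).det =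
      (oneSubWeightedPerm (Function.update w i (w i * x)) e).det := by
  set A := oneSubWeightedPerm (Fin.cons x w) (Equiv.Perm.decomposeFin.symm ((e i).succ, e)) with hA
  have hswap (k : Fin n) (hk : k ≠ i) :
      Equiv.swap 0 (e i).succ (e k).succ = (e k).succ :=
    Equiv.swap_apply_of_ne_of_ne (Fin.succ_ne_zero _) (by simpa using hk)
  -- Adding `w i` times row `0` to row `i.succ` removes the point `0` from its cycle.
  rw [← Matrix.det_updateRow_add_smul_self A (Fin.succ_ne_zero i) (w i),
    det_eq_mul_det_submatrix_succ _ fun k => ?column]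
  case column =>
    by_cases hk : k = i
    · subst hk
      simp [hA, oneSubWeightedPerm_apply, Fin.succ_ne_zero]
    · simp [hA, oneSubWeightedPerm_apply, Fin.succ_ne_zero, hswap k hk, hk]
  have hcorner : A.updateRow i.succ (A i.succ + w i • A 0) 0 0 = 1 := by
    simp [hA, oneSubWeightedPerm_apply, (Fin.succ_ne_zero _).symm]
  rw [hcorner, one_mul]
  congr 1
  ext k j
  by_cases hk : k = i
  · subst hk
    simp [hA, oneSubWeightedPerm_apply, (Fin.succ_ne_zero _).symm, sub_eq_add_neg]
  · simp [hA, oneSubWeightedPerm_apply, hswap k hk, hk]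

lemma det_oneSubWeightedPerm_pos {K : Type*} [Field K] [LinearOrder K] [IsStrictOrderedRing K]
    {n : ℕ} {w : Fin n → K} (hw0 : ∀ i, 0 ≤ w i) (hw1 : ∀ i, w i < 1) (π : Equiv.Perm (Fin n)) :
    0 < (oneSubWeightedPerm w π).det := by
  induction n with
  | zero => simp
  | succ n ih =>
    obtain ⟨⟨p, e⟩, rfl⟩ := Equiv.Perm.decomposeFin.symm.surjective π
    rw [← Fin.cons_self_tail w]
    refine Fin.cases ?_ (fun j => ?_) p
    · rw [det_oneSubWeightedPerm_decomposeFin_zero]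
      exact mul_pos (sub_pos.2 (hw1 0)) (ih (fun i => hw0 i.succ) (fun i => hw1 i.succ) e)
    · obtain ⟨i, rfl⟩ := e.surjective j
      rw [det_oneSubWeightedPerm_decomposeFin_succ]
      refine ih (fun k => ?_) (fun k => ?_) e <;> rcases eq_or_ne k i with rfl | hk
      · simpa [Fin.tail] using mul_nonneg (hw0 k.succ) (hw0 0)
      · simpa [hk, Fin.tail] using hw0 k.succ
      · simpa [Fin.tail] using mul_lt_one_of_nonneg_of_lt_one_left (hw0 _) (hw1 k.succ) (hw1 0).le
      · simpa [hk, Fin.tail] using hw1 k.succ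

lemma det_one_sub_smul_permMatrix_pos {K : Type*} [Field K] [LinearOrder K]
    [IsStrictOrderedRing K] {q : K} (hq0 : 0 ≤ q) (hq1 : q < 1) {n : ℕ} (π : Equiv.Perm (Fin n)) :
    0 < (1 - q • π.permMatrix K).det := by
  rw [← oneSubWeightedPerm_const]
  exact det_oneSubWeightedPerm_pos (fun _ => hq0) (fun _ => hq1) π

end PermutationDeterminant

section Molien

variable {K : Type*} [Field K]

/-- The sum over all permutations `π` of `1 / det (1 - D P_π)`, with `D` diagonal with entries
`w`. For constant weights `q` this is `n!` times the Molien series of the symmetric group acting on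
`n` coordinates, evaluated at `q`. -/
def permSum {n : ℕ} (w : Fin n → K) : K :=
  ∑ π : Equiv.Perm (Fin n), (oneSubWeightedPerm w π).det⁻¹

lemma permSum_comp {n : ℕ} (w : Fin n → K) (τ : Equiv.Perm (Fin n)) :
    permSum (w ∘ τ) = permSum w := by
  refine Fintype.sum_equiv (MulAut.conj τ).toEquiv _ _ fun π => ?_
  rw [det_oneSubWeightedPerm_comp]
  rfl

lemma permSum_update_const {n : ℕ} (q x : K) (i : Fin (n + 1)) :
    permSum (Function.update (fun _ => q) i x) =
      permSum (Fin.cons x fun _ : Fin n => q : Fin (n + 1) → K) := by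
  rw [← permSum_comp _ (Equiv.swap 0 i)]
  congr 1
  ext j
  refine Fin.cases (by simp) (fun j => ?_) j
  simp [Equiv.swap_apply_eq_iff, Fin.succ_ne_zero]

lemma permSum_cons {n : ℕ} (x : K) (w : Fin n → K) :
    permSum (Fin.cons x w : Fin (n + 1) → K) =
      (1 - x)⁻¹ * permSum w + ∑ i, permSum (Function.update w i (w i * x)) := by
  unfold permSum
  rw [← Equiv.sum_comp Equiv.Perm.decomposeFin.symm, Fintype.sum_prod_type, Fin.sum_univ_succ]
  congr 1
  · simp_rw [det_oneSubWeightedPerm_decomposeFin_zero, mul_inv, Finset.mul_sum]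
  · rw [Finset.sum_comm, Finset.sum_comm (t := Finset.univ (α := Equiv.Perm (Fin n)))]
    refine Finset.sum_congr rfl fun e _ => ?_
    rw [← Equiv.sum_comp e]
    simp_rw [det_oneSubWeightedPerm_decomposeFin_succ]

lemma permSum_cons_const_succ {n : ℕ} (q x : K) :
    permSum (Fin.cons x fun _ : Fin (n + 1) => q : Fin (n + 2) → K) =
      (1 - x)⁻¹ * permSum (fun _ : Fin (n + 1) => q) +
        (n + 1) * permSum (Fin.cons (q * x) fun _ : Fin n => q : Fin (n + 1) → K) := by
  rw [permSum_cons]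
  simp [permSum_update_const]

lemma permSum_cons_const (q x : K) (n : ℕ) :
    permSum (Fin.cons x fun _ : Fin n => q : Fin (n + 1) → K) =
      ∑ l ∈ Finset.range (n + 1), n.descFactorial l * (1 - q ^ l * x)⁻¹ *
        permSum (fun _ : Fin (n - l) => q) := by
  induction n generalizing x with
  | zero => simp [permSum_cons]
  | succ n ih =>
    rw [permSum_cons_const_succ, Finset.sum_range_succ', ih, add_comm, Finset.mul_sum]
    congr 1
    · refine Finset.sum_congr rfl fun l _ => ?_
      rw [Nat.succ_descFactorial_succ, Nat.add_sub_add_right, pow_succ]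
      push_cast
      ring
    · simp

/-- The `q`-Pochhammer symbol `(q; q)_n`, the inverse of the Molien series of the symmetric group
on `n` letters. -/
def qPochhammer (q : K) (n : ℕ) : K :=
  ∏ k ∈ Finset.range n, (1 - q ^ (k + 1))

lemma qPochhammer_zero (q : K) : qPochhammer q 0 = 1 := Finset.prod_range_zero _

lemma qPochhammer_succ (q : K) (n : ℕ) :
    qPochhammer q (n + 1) = qPochhammer q n * (1 - q ^ (n + 1)) :=
  Finset.prod_range_succ _ _

section

variable {q : K} (hq : ∀ k : ℕ, 1 - q ^ (k + 1) ≠ 0)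
include hq

lemma one_sub_pow_mul_inv_qPochhammer_succ (n : ℕ) :
    (1 - q ^ (n + 1)) * (qPochhammer q (n + 1))⁻¹ = (qPochhammer q n)⁻¹ := by
  rw [qPochhammer_succ, mul_inv_rev, mul_inv_cancel_left₀ (hq n)]

lemma sum_pow_mul_inv_qPochhammer (n : ℕ) :
    ∑ j ∈ Finset.range (n + 1), q ^ j * (qPochhammer q j)⁻¹ = (qPochhammer q n)⁻¹ := by
  induction n with
  | zero => simp
  | succ n ih =>
    rw [Finset.sum_range_succ, ih, ← one_sub_pow_mul_inv_qPochhammer_succ hq]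
    ring

-- In generating functions: the logarithmic derivative of Euler's product
-- `∑ n, z ^ n / (q; q)_n = ∏ k, (1 - q ^ k * z)⁻¹`.
lemma sum_inv_one_sub_pow_mul_inv_qPochhammer (n : ℕ) :
    ∑ l ∈ Finset.range (n + 1), (1 - q ^ (l + 1))⁻¹ * (qPochhammer q (n - l))⁻¹ =
      (n + 1) * (qPochhammer q (n + 1))⁻¹ := by
  induction n with
  | zero => simp [qPochhammer_succ, qPochhammer_zero]
  | succ n ih =>
    have hsplit : ∀ l ∈ Finset.range (n + 1),
        (1 - q ^ (n + 2)) * ((1 - q ^ (l + 1))⁻¹ * (qPochhammer q (n + 1 - l))⁻¹) =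
          (1 - q ^ (l + 1))⁻¹ * (qPochhammer q (n - l))⁻¹ +
            q ^ (n + 1 - l) * (qPochhammer q (n + 1 - l))⁻¹ := by
      intro l hl
      have hln : n + 1 - l = n - l + 1 := Nat.succ_sub (Finset.mem_range_succ_iff.1 hl)
      have hpow : q ^ (n + 2) = q ^ (n - l + 1) * q ^ (l + 1) := by
        rw [← pow_add]
        congr 1
        have := Finset.mem_range_succ_iff.1 hl
        omega
      rw [hln, ← one_sub_pow_mul_inv_qPochhammer_succ hq (n - l), hpow]
      have := hq l
      field_simp
      ring
    have hgeom : ∑ l ∈ Finset.range (n + 1), q ^ (n + 1 - l) * (qPochhammer q (n + 1 - l))⁻¹ + 1 =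
        (qPochhammer q (n + 1))⁻¹ := by
      rw [← sum_pow_mul_inv_qPochhammer hq (n + 1), ← Finset.sum_range_reflect _ (n + 1 + 1),
        Finset.sum_range_succ _ (n + 1)]
      simp [qPochhammer_zero]
    refine mul_left_cancel₀ (hq (n + 1)) ?_
    rw [Finset.mul_sum, Finset.sum_range_succ, Finset.sum_congr rfl hsplit,
      Finset.sum_add_distrib, ih]
    have := hq (n + 1)
    have h2 := one_sub_pow_mul_inv_qPochhammer_succ hq (n + 1)
    simp only [Nat.sub_self, qPochhammer_zero, inv_one, mul_one, mul_inv_cancel₀ this]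
    push_cast
    linear_combination hgeom - (n + 2) * h2

lemma permSum_const (n : ℕ) :
    permSum (fun _ : Fin n => q) = n.factorial * (qPochhammer q n)⁻¹ := by
  induction n using Nat.strong_induction_on with
  | _ n ih =>
    rcases n with _ | n
    · simp [permSum, qPochhammer_zero]
    have hcons : (fun _ : Fin (n + 1) => q) = Fin.cons q fun _ => q := by
      rw [← Fin.cons_self_tail fun _ : Fin (n + 1) => q]
      rfl
    have hterm : ∀ l ∈ Finset.range (n + 1),
        n.descFactorial l * (1 - q ^ l * q)⁻¹ * permSum (fun _ : Fin (n - l) => q) =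
          n.factorial * ((1 - q ^ (l + 1))⁻¹ * (qPochhammer q (n - l))⁻¹) := by
      intro l hl
      rw [ih (n - l) (by omega), ← pow_succ,
        ← Nat.factorial_mul_descFactorial (Finset.mem_range_succ_iff.1 hl)]
      push_cast
      ring
    rw [hcons, permSum_cons_const, Finset.sum_congr rfl hterm, ← Finset.mul_sum,
      sum_inv_one_sub_pow_mul_inv_qPochhammer hq, Nat.factorial_succ]
    push_cast
    ring

lemma sum_inv_det_one_sub_smul_permMatrix (n : ℕ) :
    ∑ π : Equiv.Perm (Fin n), (1 - q • π.permMatrix K).det⁻¹ =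
      n.factorial * (qPochhammer q n)⁻¹ := by
  simp_rw [← permSum_const hq, permSum, oneSubWeightedPerm_const]

end

end Molien

section QPochhammerBound

lemma one_sub_sum_le_prod_one_sub {ι R : Type*} [CommRing R] [PartialOrder R] [IsOrderedRing R]
    (s : Finset ι) {f : ι → R} (h0 : ∀ i ∈ s, 0 ≤ f i) (h1 : ∀ i ∈ s, f i ≤ 1) :
    1 - ∑ i ∈ s, f i ≤ ∏ i ∈ s, (1 - f i) := by
  classical
  induction s using Finset.induction_on with
  | empty => simp
  | insert a s ha ih =>
    rw [Finset.sum_insert ha, Finset.prod_insert ha]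
    have hs := ih (fun i hi => h0 i (Finset.mem_insert_of_mem hi))
      fun i hi => h1 i (Finset.mem_insert_of_mem hi)
    have hprod : ∏ i ∈ s, (1 - f i) ≤ 1 := Finset.prod_le_one
      (fun i hi => sub_nonneg.2 (h1 i (Finset.mem_insert_of_mem hi)))
      fun i hi => sub_le_self _ (h0 i (Finset.mem_insert_of_mem hi))
    calc 1 - (f a + ∑ i ∈ s, f i) = (1 - ∑ i ∈ s, f i) - f a * 1 := by ring
      _ ≤ ∏ i ∈ s, (1 - f i) - f a * ∏ i ∈ s, (1 - f i) :=
        sub_le_sub hs (mul_le_mul_of_nonneg_left hprod (h0 a (Finset.mem_insert_self a s)))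
      _ = (1 - f a) * ∏ i ∈ s, (1 - f i) := by ring

variable {q : ℝ}

lemma one_sub_pow_succ_pos (hq0 : 0 ≤ q) (hq1 : q < 1) (k : ℕ) : 0 < 1 - q ^ (k + 1) :=
  sub_pos.2 (pow_lt_one₀ hq0 hq1 k.succ_ne_zero)

lemma qPochhammer_pos (hq0 : 0 ≤ q) (hq1 : q < 1) (n : ℕ) : 0 < qPochhammer q n :=
  Finset.prod_pos fun k _ => one_sub_pow_succ_pos hq0 hq1 k

lemma qPochhammer_le_one (hq0 : 0 ≤ q) (hq1 : q < 1) (n : ℕ) : qPochhammer q n ≤ 1 :=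
  Finset.prod_le_one (fun k _ => (one_sub_pow_succ_pos hq0 hq1 k).le)
    fun k _ => sub_le_self 1 (pow_nonneg hq0 (k + 1))

lemma one_sub_div_le_qPochhammer (hq0 : 0 ≤ q) (hq1 : q < 1) (n : ℕ) :
    1 - q / (1 - q) ≤ qPochhammer q n := by
  have hsum : ∑ k ∈ Finset.range n, q ^ (k + 1) ≤ q / (1 - q) := by
    simp_rw [pow_succ', ← Finset.mul_sum, div_eq_mul_inv, ← tsum_geometric_of_lt_one hq0 hq1]
    gcongr
    exact (summable_geometric_of_lt_one hq0 hq1).sum_le_tsum _ fun _ _ => by positivity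
  calc 1 - q / (1 - q) ≤ 1 - ∑ k ∈ Finset.range n, q ^ (k + 1) := by gcongr
    _ ≤ qPochhammer q n := one_sub_sum_le_prod_one_sub _ (fun _ _ => by positivity)
      fun k _ => pow_le_one₀ hq0 hq1.le

end QPochhammerBound

section ProductMeasure

lemma lintegral_fin_prod_eq_prod {n : ℕ} {X : Fin n → Type*} [∀ i, MeasurableSpace (X i)]
    (μ : ∀ i, Measure (X i)) [∀ i, SigmaFinite (μ i)] {f : ∀ i, X i → ENNReal}
    (hf : ∀ i, Measurable (f i)) :
    ∫⁻ x, ∏ i, f i (x i) ∂Measure.pi μ = ∏ i, ∫⁻ x, f i x ∂μ i := by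
  induction n with
  | zero => simp
  | succ n ih =>
    have e := (measurePreserving_piFinSuccAbove μ 0).symm
    rw [← e.lintegral_comp (by fun_prop), Fin.prod_univ_succ, ← ih (fun i => μ i.succ)
      fun i => hf i.succ, ← lintegral_prod_mul (hf 0).aemeasurable
        (Finset.measurable_fun_prod _ fun i _ => by fun_prop).aemeasurable]
    refine lintegral_congr fun p => ?_
    rw [Fin.prod_univ_succ]
    rfl

variable {ι : Type*} [Fintype ι] {X : ι → Type*} [∀ i, MeasurableSpace (X i)]
  (μ : ∀ i, Measure (X i)) [∀ i, SigmaFinite (μ i)] {f : ∀ i, X i → ENNReal}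

lemma lintegral_pi_prod_eq_prod (hf : ∀ i, Measurable (f i)) :
    ∫⁻ x, ∏ i, f i (x i) ∂Measure.pi μ = ∏ i, ∫⁻ x, f i x ∂μ i := by
  let e := (Fintype.equivFin ι).symm
  rw [← (measurePreserving_piCongrLeft μ e).lintegral_comp (by fun_prop)]
  simp_rw [← e.prod_comp, MeasurableEquiv.coe_piCongrLeft, Equiv.piCongrLeft_apply_apply,
    lintegral_fin_prod_eq_prod _ fun i => hf (e i)]

lemma pi_withDensity (hf : ∀ i, Measurable (f i)) [∀ i, SigmaFinite ((μ i).withDensity (f i))] :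
    Measure.pi (fun i => (μ i).withDensity (f i)) =
      (Measure.pi μ).withDensity fun x => ∏ i, f i (x i) := by
  classical
  refine Measure.pi_eq fun s hs => ?_
  have hind : ((Set.univ.pi s).indicator fun x => ∏ i, f i (x i)) =
      fun x => ∏ i, (s i).indicator (f i) (x i) := by
    ext x
    simp [Set.indicator_apply, Finset.prod_ite_zero]
  rw [withDensity_apply _ (.univ_pi hs), ← lintegral_indicator (.univ_pi hs), hind,
    lintegral_pi_prod_eq_prod _ fun i => (hf i).indicator (hs i)]
  simp_rw [lintegral_indicator (hs _), withDensity_apply _ (hs _)]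

end ProductMeasure

section CorrelatedPair

lemma map_toEuclideanCLM_stdGaussian {ι : Type*} [Fintype ι] [DecidableEq ι]
    (A : Matrix ι ι ℝ) :
    (stdGaussian (EuclideanSpace ℝ ι)).map (Matrix.toEuclideanCLM (𝕜 := ℝ) A) =
      multivariateGaussian 0 (A * A.transpose) := by
  refine Measure.ext_of_charFun (funext fun t => ?_)
  have hadj (x : EuclideanSpace ℝ ι) : inner ℝ (Matrix.toEuclideanCLM (𝕜 := ℝ) A x) t =
      inner ℝ x (Matrix.toEuclideanCLM (𝕜 := ℝ) A.transpose t) := by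
    rw [← ContinuousLinearMap.adjoint_inner_right, ← ContinuousLinearMap.star_eq_adjoint,
      ← map_star, Matrix.star_eq_conjTranspose, Matrix.conjTranspose_eq_transpose_of_trivial]
  have hnorm : ‖Matrix.toEuclideanCLM (𝕜 := ℝ) A.transpose t‖ ^ 2 =
      t.ofLp ⬝ᵥ (A * A.transpose).mulVec t.ofLp := by
    rw [← real_inner_self_eq_norm_sq, ← hadj, real_inner_comm, Matrix.inner_toEuclideanCLM,
      Matrix.ofLp_toEuclideanCLM, Matrix.mulVec_mulVec]
  have hpos : (A * A.transpose).PosSemidef := by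
    simpa using Matrix.posSemidef_self_mul_conjTranspose A
  rw [charFun_multivariateGaussian hpos, ← hnorm, charFun_apply,
    integral_map (by fun_prop) (by fun_prop)]
  simp_rw [hadj]
  rw [← charFun_apply, charFun_stdGaussian]
  simp [neg_div]

lemma gaussianReal_map_add_sqrt_mul (m v : ℝ) :
    (gaussianReal 0 1).map (fun z => m + √v * z) = gaussianReal m v.toNNReal := by
  have hcomp : (fun z => m + √v * z) = (m + ·) ∘ (√v * ·) := rfl
  have hv : NNReal.mk (√v ^ 2) (sq_nonneg _) = v.toNNReal :=
    NNReal.eq (Real.sq_sqrt'.trans (Real.coe_toNNReal' v).symm)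
  rw [hcomp, ← Measure.map_map (by fun_prop) (by fun_prop), gaussianReal_map_const_mul,
    gaussianReal_map_const_add, hv, mul_zero, zero_add, mul_one]

lemma map_multivariateGaussian_corrMatrix {ρ : ℝ} (hρ : |ρ| ≤ 1) :
    (multivariateGaussian 0 (corrMatrix ρ)).map (fun w => (w 0, w 1)) =
      ((gaussianReal 0 1).prod (gaussianReal 0 1)).map
        fun p => (p.1, ρ * p.1 + √(1 - ρ ^ 2) * p.2) := by
  set A : Matrix (Fin 2) (Fin 2) ℝ := !![1, 0; ρ, √(1 - ρ ^ 2)] with hA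
  have hsqrt : √(1 - ρ ^ 2) ^ 2 = 1 - ρ ^ 2 :=
    Real.sq_sqrt (sub_nonneg.2 ((sq_le_one_iff_abs_le_one ρ).2 hρ))
  have hcholesky : corrMatrix ρ = A * A.transpose := by
    ext i j
    fin_cases i <;> fin_cases j <;>
      simp [corrMatrix, hA, Matrix.mul_apply, Fin.sum_univ_two, ← sq, hsqrt]
  have hcoord : ((fun w : EuclideanSpace ℝ (Fin 2) => (w 0, w 1)) ∘
      Matrix.toEuclideanCLM (𝕜 := ℝ) A) ∘ WithLp.toLp 2 =
      (fun p : ℝ × ℝ => (p.1, ρ * p.1 + √(1 - ρ ^ 2) * p.2)) ∘ MeasurableEquiv.finTwoArrow := by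
    ext z <;> simp [hA, MeasurableEquiv.finTwoArrow, Matrix.vecHead, Matrix.vecTail]
  rw [hcholesky, ← map_toEuclideanCLM_stdGaussian, ← map_pi_eq_stdGaussian,
    Measure.map_map (by fun_prop) (by fun_prop), Measure.map_map (by fun_prop) (by fun_prop),
    hcoord, ← Measure.map_map (by fun_prop) (by fun_prop),
    (measurePreserving_finTwoArrow _).map_eq]

lemma map_prodMk_eq_withDensity {α β γ : Type*} [MeasurableSpace α] [MeasurableSpace β]
    [MeasurableSpace γ] (μ : Measure α) {ν : Measure β} {ν' : Measure γ} [SFinite ν] [SFinite ν']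
    {g : α → β → γ} {f : α → γ → ENNReal} (hg : Measurable fun p : α × β => g p.1 p.2)
    (hf : Measurable fun p : α × γ => f p.1 p.2) (h : ∀ x, ν.map (g x) = ν'.withDensity (f x)) :
    (μ.prod ν).map (fun p => (p.1, g p.1 p.2)) =
      (μ.prod ν').withDensity fun p => f p.1 p.2 := by
  refine Measure.ext_of_lintegral _ fun F hF => ?_
  rw [lintegral_map hF (by fun_prop), lintegral_withDensity_eq_lintegral_mul _ hf hF,
    lintegral_prod _ (by fun_prop), lintegral_prod _ (by fun_prop)]
  refine lintegral_congr fun x => ?_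
  have hgx : Measurable (g x) := hg.comp measurable_prodMk_left
  have hfx : Measurable (f x) := hf.comp measurable_prodMk_left
  calc ∫⁻ y, F (x, g x y) ∂ν = ∫⁻ z, F (x, z) ∂ν.map (g x) :=
        (lintegral_map (f := fun z => F (x, z)) (by fun_prop) hgx).symm
    _ = ∫⁻ z, f x z * F (x, z) ∂ν' := by
        rw [h x, lintegral_withDensity_eq_lintegral_mul _ hfx (by fun_prop)]
        rfl

/-- The density at `(x, y)` of a pair of standard Gaussian variables with correlation `ρ` with
respect to a pair of independent standard Gaussian variables. The formula is the conditional
density of the second variable given the first, over its marginal density. -/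
def corrDensity (ρ x y : ℝ) : ENNReal :=
  gaussianPDF 0 (1 - ρ ^ 2).toNNReal (y - ρ * x) / gaussianPDF 0 1 y

@[fun_prop]
lemma measurable_corrDensity (ρ : ℝ) : Measurable fun p : ℝ × ℝ => corrDensity ρ p.1 p.2 := by
  have := measurable_gaussianPDF
  unfold corrDensity
  fun_prop

lemma gaussianPDF_mul_corrDensity (ρ x y : ℝ) :
    gaussianPDF 0 1 y * corrDensity ρ x y = gaussianPDF 0 (1 - ρ ^ 2).toNNReal (y - ρ * x) :=
  ENNReal.mul_div_cancel (gaussianPDF_pos 0 one_ne_zero y).ne' gaussianPDF_ne_top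

lemma corrDensity_zero (x y : ℝ) : corrDensity 0 x y = 1 := by
  simpa [corrDensity] using
    ENNReal.div_self (gaussianPDF_pos 0 one_ne_zero y).ne' gaussianPDF_ne_top

section

variable {ρ : ℝ} (hρ : |ρ| < 1)
include hρ

lemma one_sub_sq_pos_of_abs_lt_one : 0 < 1 - ρ ^ 2 :=
  sub_pos.2 ((sq_lt_one_iff_abs_lt_one ρ).2 hρ)

lemma corrDensity_comm (x y : ℝ) : corrDensity ρ x y = corrDensity ρ y x := by
  have h2 := one_sub_sq_pos_of_abs_lt_one hρ
  unfold corrDensity gaussianPDF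
  rw [← ENNReal.ofReal_div_of_pos (gaussianPDFReal_pos _ _ _ one_ne_zero),
    ← ENNReal.ofReal_div_of_pos (gaussianPDFReal_pos _ _ _ one_ne_zero)]
  congr 1
  rw [div_eq_div_iff (gaussianPDFReal_pos _ _ _ one_ne_zero).ne'
    (gaussianPDFReal_pos _ _ _ one_ne_zero).ne']
  simp only [gaussianPDFReal, Real.coe_toNNReal _ h2.le, NNReal.coe_one]
  rw [mul_mul_mul_comm, mul_mul_mul_comm _ _ _ (Real.exp (-(y - 0) ^ 2 / (2 * 1))),
    ← Real.exp_add, ← Real.exp_add]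
  congr 2
  field_simp
  ring

lemma gaussianReal_eq_withDensity_corrDensity (x : ℝ) :
    gaussianReal (ρ * x) (1 - ρ ^ 2).toNNReal =
      (gaussianReal 0 1).withDensity (corrDensity ρ x) := by
  have hv : (1 - ρ ^ 2).toNNReal ≠ 0 := by simpa using one_sub_sq_pos_of_abs_lt_one hρ
  rw [gaussianReal_of_var_ne_zero _ hv, gaussianReal_of_var_ne_zero _ one_ne_zero,
    ← withDensity_mul _ (measurable_gaussianPDF _ _) (by fun_prop)]
  congr 1
  ext y
  rw [Pi.mul_apply, gaussianPDF_mul_corrDensity]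
  simp [gaussianPDF, gaussianPDFReal]

lemma map_multivariateGaussian_corrMatrix_eq_withDensity :
    (multivariateGaussian 0 (corrMatrix ρ)).map (fun w => (w 0, w 1)) =
      ((gaussianReal 0 1).prod (gaussianReal 0 1)).withDensity
        fun p => corrDensity ρ p.1 p.2 := by
  rw [map_multivariateGaussian_corrMatrix hρ.le]
  refine map_prodMk_eq_withDensity (g := fun x z => ρ * x + √(1 - ρ ^ 2) * z) _ (by fun_prop)
    (measurable_corrDensity ρ) fun x => ?_
  rw [gaussianReal_map_add_sqrt_mul, gaussianReal_eq_withDensity_corrDensity hρ]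

end

end CorrelatedPair

section PlantedDensity

/-- The law of a sequence of `n` independent standard Gaussian variables. -/
abbrev stdGaussianPi (n : ℕ) : Measure (Fin n → ℝ) := Measure.pi fun _ => gaussianReal 0 1

/-- The likelihood ratio of the planted law with hidden permutation `σ` with respect to the null
law. -/
def plantedDensity (ρ : ℝ) {n : ℕ} (σ : Equiv.Perm (Fin n)) (z : Obs n) : ENNReal :=
  ∏ i, corrDensity ρ (z.1 i) (z.2 (σ i))

@[fun_prop]
lemma measurable_plantedDensity (ρ : ℝ) {n : ℕ} (σ : Equiv.Perm (Fin n)) :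
    Measurable (plantedDensity ρ σ) := by
  have h (i : Fin n) : Measurable fun z : Obs n => corrDensity ρ (z.1 i) (z.2 (σ i)) :=
    (measurable_corrDensity ρ).comp (g := fun p : ℝ × ℝ => corrDensity ρ p.1 p.2)
      (f := fun z : Obs n => (z.1 i, z.2 (σ i))) (by fun_prop)
  exact Finset.measurable_fun_prod _ fun i _ => h i

/-- Splits a sequence of pairs into two sequences `X` and `Y`, permuting the second one so that
`(X i, Y (σ i))` is the `i`-th pair. -/
def unzipPerm {n : ℕ} (σ : Equiv.Perm (Fin n)) (v : Fin n → ℝ × ℝ) : Obs n :=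
  (fun i => (v i).1, fun j => (v (σ.symm j)).2)

lemma measurePreserving_unzipPerm {n : ℕ} (σ : Equiv.Perm (Fin n)) :
    MeasurePreserving (unzipPerm σ)
      (Measure.pi fun _ => (gaussianReal 0 1).prod (gaussianReal 0 1))
      ((stdGaussianPi n).prod (stdGaussianPi n)) := by
  have hunzip := measurePreserving_arrowProdEquivProdArrow ℝ ℝ (Fin n)
    (fun _ => gaussianReal 0 1) (fun _ => gaussianReal 0 1)
  have hperm := (MeasurePreserving.id (stdGaussianPi n)).prod
    (measurePreserving_piCongrLeft (fun _ : Fin n => gaussianReal 0 1) σ)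
  convert hperm.comp hunzip using 1
  ext v j
  · rfl
  · obtain ⟨k, rfl⟩ := σ.surjective j
    simp [unzipPerm, MeasurableEquiv.coe_piCongrLeft, MeasurableEquiv.arrowProdEquivProdArrow,
      Equiv.arrowProdEquivProdArrow, Equiv.piCongrLeft_apply_apply]

lemma plantedLaw_eq_map_unzipPerm (ρ : ℝ) {n : ℕ} (σ : Equiv.Perm (Fin n)) :
    plantedLaw ρ n σ =
      (Measure.pi fun _ => (multivariateGaussian 0 (corrMatrix ρ)).map
        fun w => (w 0, w 1)).map (unzipPerm σ) := by
  have hpair : Measurable fun w : EuclideanSpace ℝ (Fin 2) => (w 0, w 1) := by fun_prop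
  have : IsProbabilityMeasure
      ((multivariateGaussian 0 (corrMatrix ρ)).map fun w => (w 0, w 1)) :=
    Measure.isProbabilityMeasure_map hpair.aemeasurable
  rw [← Measure.pi_map_pi fun _ => hpair.aemeasurable,
    Measure.map_map (measurePreserving_unzipPerm σ).measurable (by fun_prop)]
  rfl

lemma plantedLaw_eq_withDensity {ρ : ℝ} (hρ : |ρ| < 1) {n : ℕ} (σ : Equiv.Perm (Fin n)) :
    plantedLaw ρ n σ =
      ((stdGaussianPi n).prod (stdGaussianPi n)).withDensity (plantedDensity ρ σ) := by
  have hunzip := measurePreserving_unzipPerm σ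
  have hprob : IsProbabilityMeasure
      ((multivariateGaussian 0 (corrMatrix ρ)).map fun w => (w 0, w 1)) :=
    Measure.isProbabilityMeasure_map (by fun_prop)
  rw [plantedLaw_eq_map_unzipPerm]
  rw [map_multivariateGaussian_corrMatrix_eq_withDensity hρ] at hprob ⊢
  rw [pi_withDensity _ fun _ => measurable_corrDensity ρ]
  refine Measure.ext_of_lintegral _ fun F hF => ?_
  have hFunzip : Measurable fun v => F (unzipPerm σ v) := hF.comp hunzip.measurable
  rw [lintegral_map hF hunzip.measurable,
    lintegral_withDensity_eq_lintegral_mul _ (by fun_prop) hF,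
    lintegral_withDensity_eq_lintegral_mul _ (by fun_prop) hFunzip,
    ← hunzip.lintegral_comp (by fun_prop)]
  refine lintegral_congr fun v => ?_
  simp [plantedDensity, unzipPerm]

lemma nullLaw_eq_prod (n : ℕ) : nullLaw n = (stdGaussianPi n).prod (stdGaussianPi n) := by
  have hone : plantedDensity 0 (1 : Equiv.Perm (Fin n)) = 1 := by
    ext z
    exact Finset.prod_eq_one fun i _ => corrDensity_zero _ _
  have h := plantedLaw_eq_withDensity (ρ := 0) (by simp) (1 : Equiv.Perm (Fin n))
  rwa [hone, withDensity_one] at h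

end PlantedDensity

section PairCorrelation

open Matrix

lemma measurable_mulVec {m n : Type*} [Fintype n] (M : Matrix m n ℝ) :
    Measurable fun v : n → ℝ => M *ᵥ v := by
  unfold mulVec dotProduct
  fun_prop

section

variable {ι : Type*} [Fintype ι] [DecidableEq ι]

lemma lintegral_comp_mulVec_sub {M : Matrix ι ι ℝ} (hM : M.det ≠ 0) (c : ι → ℝ)
    {H : (ι → ℝ) → ENNReal} (hH : Measurable H) :
    ∫⁻ y, H (M *ᵥ y - c) = ENNReal.ofReal |M.det|⁻¹ * ∫⁻ y, H y := by
  have hmap := lintegral_map (μ := volume) (f := fun u => H (u - c)) (g := Matrix.toLin' M)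
    (by fun_prop) (measurable_mulVec M)
  rw [Real.map_matrix_volume_pi_eq_smul_volume_pi hM, lintegral_smul_measure,
    lintegral_sub_right_eq_self H, abs_inv, smul_eq_mul] at hmap
  exact hmap.symm

lemma lintegral_lintegral_mul_comp_mulVec_sub {A B C : Matrix ι ι ℝ}
    (hdet : (A - C * B).det ≠ 0) {G H : (ι → ℝ) → ENNReal} (hG : Measurable G)
    (hH : Measurable H) :
    ∫⁻ y, ∫⁻ x, G (x - B *ᵥ y) * H (A *ᵥ y - C *ᵥ x) =
      ENNReal.ofReal |(A - C * B).det|⁻¹ * ((∫⁻ x, G x) * ∫⁻ y, H y) := by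
  have hshear (x y : ι → ℝ) : A *ᵥ y - C *ᵥ (x + B *ᵥ y) = (A - C * B) *ᵥ y - C *ᵥ x := by
    rw [mulVec_add, mulVec_mulVec, sub_mulVec]
    abel
  have hAC := measurable_mulVec (A - C * B)
  have hC := measurable_mulVec C
  calc ∫⁻ y, ∫⁻ x, G (x - B *ᵥ y) * H (A *ᵥ y - C *ᵥ x)
      = ∫⁻ y, ∫⁻ x, G x * H ((A - C * B) *ᵥ y - C *ᵥ x) := by
        refine lintegral_congr fun y => ?_
        rw [← lintegral_add_right_eq_self _ (B *ᵥ y)]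
        simp_rw [add_sub_cancel_right, hshear]
    _ = ∫⁻ x, ∫⁻ y, G x * H ((A - C * B) *ᵥ y - C *ᵥ x) :=
        lintegral_lintegral_swap (Measurable.aemeasurable (by fun_prop))
    _ = ∫⁻ x, G x * (ENNReal.ofReal |(A - C * B).det|⁻¹ * ∫⁻ y, H y) := by
        refine lintegral_congr fun x => ?_
        rw [lintegral_const_mul _ (by fun_prop), lintegral_comp_mulVec_sub hdet _ hH]
    _ = ENNReal.ofReal |(A - C * B).det|⁻¹ * ((∫⁻ x, G x) * ∫⁻ y, H y) := by
        rw [lintegral_mul_const _ hG]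
        ring

end

lemma abs_det_permMatrix_sub_smul_permMatrix {ι : Type*} [Fintype ι] [DecidableEq ι] {R : Type*}
    [CommRing R] [LinearOrder R] [IsStrictOrderedRing R] (q : R) (σ τ : Equiv.Perm ι) :
    |(σ.permMatrix R - q • τ.permMatrix R).det| = |(1 - q • (σ⁻¹ * τ).permMatrix R).det| := by
  have hfactor : σ.permMatrix R - q • τ.permMatrix R =
      (1 - q • (σ⁻¹ * τ).permMatrix R) * σ.permMatrix R := by
    rw [sub_mul, one_mul, smul_mul_assoc, ← permMatrix_mul, mul_inv_cancel_left]
  rw [hfactor, det_mul, det_permutation, abs_mul]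
  rcases Int.units_eq_one_or (Equiv.Perm.sign σ) with h | h <;> simp [h]

lemma lintegral_prod_gaussianPDF {ι : Type*} [Fintype ι] (m : ℝ) {v : NNReal} (hv : v ≠ 0) :
    ∫⁻ x : ι → ℝ, ∏ i, gaussianPDF m v (x i) = 1 := by
  rw [volume_pi, lintegral_pi_prod_eq_prod _ fun _ => measurable_gaussianPDF _ _]
  simp [lintegral_gaussianPDF_eq_one m hv]

lemma stdGaussianPi_eq_withDensity (n : ℕ) :
    stdGaussianPi n = volume.withDensity fun x => ∏ i, gaussianPDF 0 1 (x i) := by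
  have : IsProbabilityMeasure (volume.withDensity (gaussianPDF 0 1)) := by
    rw [← gaussianReal_of_var_ne_zero 0 one_ne_zero]
    infer_instance
  rw [stdGaussianPi, gaussianReal_of_var_ne_zero 0 one_ne_zero,
    pi_withDensity _ fun _ => measurable_gaussianPDF _ _, volume_pi]

variable {ρ : ℝ} (hρ : |ρ| < 1) {n : ℕ} (σ τ : Equiv.Perm (Fin n))
include hρ

lemma prod_gaussianPDF_mul_plantedDensity_mul (x y : Fin n → ℝ) :
    (∏ i, gaussianPDF 0 1 (x i)) * (∏ i, gaussianPDF 0 1 (y i)) *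
        (plantedDensity ρ σ (x, y) * plantedDensity ρ τ (x, y)) =
      (∏ i, gaussianPDF 0 (1 - ρ ^ 2).toNNReal (x i - ρ * y (τ i))) *
        ∏ i, gaussianPDF 0 (1 - ρ ^ 2).toNNReal (y (σ i) - ρ * x i) := by
  rw [← Equiv.prod_comp σ fun i => gaussianPDF 0 1 (y i)]
  simp_rw [plantedDensity, ← Finset.prod_mul_distrib]
  refine Finset.prod_congr rfl fun i _ => ?_
  rw [← gaussianPDF_mul_corrDensity, ← gaussianPDF_mul_corrDensity,
    corrDensity_comm hρ (y (τ i))]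
  ring

lemma lintegral_plantedDensity_mul_plantedDensity :
    ∫⁻ z, plantedDensity ρ σ z * plantedDensity ρ τ z
        ∂(stdGaussianPi n).prod (stdGaussianPi n) =
      ENNReal.ofReal (1 - ρ ^ 2 • (σ⁻¹ * τ).permMatrix ℝ).det⁻¹ := by
  have hq : ρ ^ 2 < 1 := (sq_lt_one_iff_abs_lt_one ρ).2 hρ
  have hv : (1 - ρ ^ 2).toNNReal ≠ 0 := by simpa using hq
  set g : ℝ → ENNReal := gaussianPDF 0 (1 - ρ ^ 2).toNNReal
  have hg : Measurable g := measurable_gaussianPDF _ _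
  have hpos := det_one_sub_smul_permMatrix_pos (sq_nonneg ρ) hq (σ⁻¹ * τ)
  have hmatrix : σ.permMatrix ℝ - (ρ • (1 : Matrix (Fin n) (Fin n) ℝ)) * (ρ • τ.permMatrix ℝ) =
      σ.permMatrix ℝ - ρ ^ 2 • τ.permMatrix ℝ := by
    rw [smul_mul_smul_comm, one_mul, sq]
  have hdet := abs_det_permMatrix_sub_smul_permMatrix (ρ ^ 2) σ τ
  rw [abs_of_pos hpos, ← hmatrix] at hdet
  have hintegral := lintegral_lintegral_mul_comp_mulVec_sub (G := fun x => ∏ i, g (x i))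
    (H := fun y => ∏ i, g (y i)) (abs_pos.1 (hdet ▸ hpos)) (by fun_prop) (by fun_prop)
  rw [hdet, lintegral_prod_gaussianPDF 0 hv, mul_one, mul_one] at hintegral
  rw [← hintegral, stdGaussianPi_eq_withDensity, prod_withDensity (by fun_prop) (by fun_prop),
    lintegral_withDensity_eq_lintegral_mul _ (by fun_prop) (by fun_prop),
    lintegral_prod_symm _ (by fun_prop)]
  refine lintegral_congr fun y => lintegral_congr fun x => ?_
  simpa [smul_mulVec, permMatrix_mulVec, g] using prod_gaussianPDF_mul_plantedDensity_mul hρ σ τ x y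

end PairCorrelation

section LikelihoodRatio

/-- The likelihood ratio of the alternative with respect to the null hypothesis. -/
def likelihoodRatio (ρ : ℝ) (n : ℕ) (z : Obs n) : ENNReal :=
  (n.factorial : ENNReal)⁻¹ * ∑ σ : Equiv.Perm (Fin n), plantedDensity ρ σ z

@[fun_prop]
lemma measurable_likelihoodRatio (ρ : ℝ) (n : ℕ) : Measurable (likelihoodRatio ρ n) := by
  unfold likelihoodRatio
  fun_prop

lemma likelihoodRatio_sq (ρ : ℝ) (n : ℕ) (z : Obs n) :
    likelihoodRatio ρ n z ^ 2 = (n.factorial : ENNReal)⁻¹ ^ 2 *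
      ∑ σ : Equiv.Perm (Fin n), ∑ τ, plantedDensity ρ σ z * plantedDensity ρ τ z := by
  rw [likelihoodRatio, mul_pow, sq (∑ σ, _), Finset.sum_mul_sum]

section

variable {ρ : ℝ} (hρ : |ρ| < 1)
include hρ

lemma altLaw_eq_withDensity (n : ℕ) :
    altLaw ρ n = (nullLaw n).withDensity (likelihoodRatio ρ n) := by
  refine Measure.ext_of_lintegral _ fun F hF => ?_
  rw [lintegral_withDensity_eq_lintegral_mul _ (measurable_likelihoodRatio ρ n) hF, altLaw,
    lintegral_smul_measure, lintegral_finsetSum_measure, nullLaw_eq_prod]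
  simp_rw [plantedLaw_eq_withDensity hρ,
    lintegral_withDensity_eq_lintegral_mul _ (measurable_plantedDensity ρ _) hF]
  rw [← lintegral_finsetSum _ (by fun_prop), Fintype.card_perm, Fintype.card_fin, smul_eq_mul,
    ← lintegral_const_mul _ (by fun_prop)]
  refine lintegral_congr fun z => ?_
  simp only [likelihoodRatio, Pi.mul_apply]
  rw [mul_assoc, Finset.sum_mul]

lemma sum_lintegral_plantedDensity_mul {n : ℕ} (σ : Equiv.Perm (Fin n)) :
    ∑ τ, ∫⁻ z, plantedDensity ρ σ z * plantedDensity ρ τ z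
        ∂(stdGaussianPi n).prod (stdGaussianPi n) =
      ENNReal.ofReal (n.factorial * (qPochhammer (ρ ^ 2) n)⁻¹) := by
  have hq : ρ ^ 2 < 1 := (sq_lt_one_iff_abs_lt_one ρ).2 hρ
  have hdet (π : Equiv.Perm (Fin n)) :=
    inv_nonneg.2 (det_one_sub_smul_permMatrix_pos (sq_nonneg ρ) hq π).le
  simp_rw [lintegral_plantedDensity_mul_plantedDensity hρ]
  rw [← ENNReal.ofReal_sum_of_nonneg fun τ _ => hdet (σ⁻¹ * τ),
    (Group.mulLeft_bijective σ⁻¹).sum_comp fun π => (1 - ρ ^ 2 • π.permMatrix ℝ).det⁻¹,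
    sum_inv_det_one_sub_smul_permMatrix
      fun k => (one_sub_pow_succ_pos (sq_nonneg ρ) hq k).ne']

lemma lintegral_likelihoodRatio_sq (n : ℕ) :
    ∫⁻ z, likelihoodRatio ρ n z ^ 2 ∂nullLaw n =
      ENNReal.ofReal (qPochhammer (ρ ^ 2) n)⁻¹ := by
  have hsum (σ : Equiv.Perm (Fin n)) :
      ∫⁻ z, ∑ τ, plantedDensity ρ σ z * plantedDensity ρ τ z ∂nullLaw n =
        ENNReal.ofReal (n.factorial * (qPochhammer (ρ ^ 2) n)⁻¹) := by
    rw [lintegral_finsetSum _ (by fun_prop), nullLaw_eq_prod, sum_lintegral_plantedDensity_mul hρ]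
  simp_rw [likelihoodRatio_sq]
  rw [lintegral_const_mul _ (by fun_prop), lintegral_finsetSum _ (by fun_prop)]
  simp_rw [hsum]
  rw [Finset.sum_const, Finset.card_univ, Fintype.card_perm, Fintype.card_fin, nsmul_eq_mul,
    ENNReal.ofReal_mul (by positivity), ENNReal.ofReal_natCast, ← mul_assoc (n.factorial : ENNReal),
    ← mul_assoc, ← sq, ← mul_pow,
    ENNReal.inv_mul_cancel (by positivity) (ENNReal.natCast_ne_top _), one_pow, one_mul]

end

instance isProbabilityMeasure_nullLaw (n : ℕ) : IsProbabilityMeasure (nullLaw n) := by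
  rw [nullLaw_eq_prod]
  infer_instance

instance isProbabilityMeasure_plantedLaw (ρ : ℝ) (n : ℕ) (σ : Equiv.Perm (Fin n)) :
    IsProbabilityMeasure (plantedLaw ρ n σ) :=
  Measure.isProbabilityMeasure_map
    (show Measurable (toObs σ) by unfold toObs; fun_prop).aemeasurable

instance isProbabilityMeasure_altLaw (ρ : ℝ) (n : ℕ) : IsProbabilityMeasure (altLaw ρ n) := by
  refine ⟨?_⟩
  simp only [altLaw, Measure.smul_apply, Measure.coe_finsetSum, Finset.sum_apply, measure_univ,
    Finset.sum_const, Finset.card_univ, nsmul_eq_mul, mul_one, smul_eq_mul]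
  exact ENNReal.inv_mul_cancel (by simp [Fintype.card_ne_zero]) (ENNReal.natCast_ne_top _)

end LikelihoodRatio

section SecondMoment

lemma abs_sub_le_sqrt_div_two {p q a b : ℝ} (hp0 : 0 ≤ p) (hp1 : p ≤ 1) (ha : q ^ 2 ≤ p * a)
    (hb : (1 - q) ^ 2 ≤ (1 - p) * b) (hab : 1 ≤ a + b) : |p - q| ≤ √(a + b - 1) / 2 := by
  have hsq : (p - q) ^ 2 ≤ p * (1 - p) * (a + b - 1) := by
    calc (p - q) ^ 2 = (1 - p) * q ^ 2 + p * (1 - q) ^ 2 - p * (1 - p) := by ring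
      _ ≤ (1 - p) * (p * a) + p * ((1 - p) * b) - p * (1 - p) :=
        sub_le_sub_right (add_le_add (mul_le_mul_of_nonneg_left ha (sub_nonneg.2 hp1))
          (mul_le_mul_of_nonneg_left hb hp0)) _
      _ = p * (1 - p) * (a + b - 1) := by ring
  have hvar : p * (1 - p) ≤ 1 / 4 := by linarith [sq_nonneg (p - 1 / 2)]
  refine abs_le_of_sq_le_sq ?_ (by positivity)
  rw [div_pow, Real.sq_sqrt (sub_nonneg.2 hab)]
  linarith [mul_le_mul_of_nonneg_right hvar (sub_nonneg.2 hab)]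

variable {Ω : Type*} [MeasurableSpace Ω] (μ : Measure Ω) {L : Ω → ENNReal} (hL : Measurable L)
include hL

lemma sq_setLIntegral_le (A : Set Ω) :
    (∫⁻ ω in A, L ω ∂μ) ^ 2 ≤ μ A * ∫⁻ ω in A, L ω ^ 2 ∂μ := by
  have hholder := ENNReal.lintegral_mul_le_Lp_mul_Lq (μ.restrict A) Real.HolderConjugate.two_two
    (f := 1) aemeasurable_one hL.aemeasurable
  calc (∫⁻ ω in A, L ω ∂μ) ^ 2
      ≤ (μ A ^ (1 / 2 : ℝ) * (∫⁻ ω in A, L ω ^ 2 ∂μ) ^ (1 / 2 : ℝ)) ^ 2 := by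
        gcongr
        simpa using hholder
    _ = μ A * ∫⁻ ω in A, L ω ^ 2 ∂μ := by
        rw [mul_pow, ← ENNReal.rpow_natCast, ← ENNReal.rpow_natCast, ← ENNReal.rpow_mul,
          ← ENNReal.rpow_mul]
        norm_num

variable (hL2 : ∫⁻ ω, L ω ^ 2 ∂μ ≠ ⊤)
include hL2

lemma sq_measureReal_withDensity_le [IsFiniteMeasure μ] {A : Set Ω} (hA : MeasurableSet A) :
    (μ.withDensity L).real A ^ 2 ≤ μ.real A * (∫⁻ ω in A, L ω ^ 2 ∂μ).toReal := by
  have hfin : ∫⁻ ω in A, L ω ^ 2 ∂μ ≠ ⊤ := ne_top_of_le_ne_top hL2 (setLIntegral_le_lintegral _ _)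
  rw [Measure.real, Measure.real, ← ENNReal.toReal_pow, ← ENNReal.toReal_mul,
    withDensity_apply _ hA]
  exact ENNReal.toReal_mono (ENNReal.mul_ne_top (measure_ne_top _ _) hfin)
    (sq_setLIntegral_le μ hL A)

lemma abs_measureReal_sub_withDensity_le [IsProbabilityMeasure μ]
    [IsProbabilityMeasure (μ.withDensity L)] {A : Set Ω} (hA : MeasurableSet A) :
    |μ.real A - (μ.withDensity L).real A| ≤ √((∫⁻ ω, L ω ^ 2 ∂μ).toReal - 1) / 2 := by
  have huniv := sq_measureReal_withDensity_le μ hL hL2 .univ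
  have hleft := sq_measureReal_withDensity_le μ hL hL2 hA
  have hright := sq_measureReal_withDensity_le μ hL hL2 hA.compl
  have hadd : (∫⁻ ω, L ω ^ 2 ∂μ).toReal =
      (∫⁻ ω in A, L ω ^ 2 ∂μ).toReal + (∫⁻ ω in Aᶜ, L ω ^ 2 ∂μ).toReal := by
    rw [← ENNReal.toReal_add (ne_top_of_le_ne_top hL2 (setLIntegral_le_lintegral _ _))
      (ne_top_of_le_ne_top hL2 (setLIntegral_le_lintegral _ _)), lintegral_add_compl _ hA]
  rw [probReal_univ, probReal_univ, setLIntegral_univ, one_pow, one_mul, hadd] at huniv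
  rw [probReal_compl_eq_one_sub hA, probReal_compl_eq_one_sub hA] at hright
  rw [hadd]
  exact abs_sub_le_sqrt_div_two measureReal_nonneg measureReal_le_one hleft hright huniv

end SecondMoment

section Risk

lemma one_sub_sqrt_le_risk {ρ : ℝ} (hρ : |ρ| < 1) {n : ℕ} {φ : Obs n → Fin 2}
    (hφ : Measurable φ) : 1 - √((qPochhammer (ρ ^ 2) n)⁻¹ - 1) / 2 ≤ risk ρ n φ := by
  have hQ := qPochhammer_pos (sq_nonneg ρ) ((sq_lt_one_iff_abs_lt_one ρ).2 hρ) n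
  have halt := altLaw_eq_withDensity hρ n
  have hprob : IsProbabilityMeasure ((nullLaw n).withDensity (likelihoodRatio ρ n)) :=
    halt ▸ isProbabilityMeasure_altLaw ρ n
  have hA : MeasurableSet {z | φ z = 0} := hφ (measurableSet_singleton 0)
  have hsecond := lintegral_likelihoodRatio_sq hρ n
  have htv := abs_measureReal_sub_withDensity_le (nullLaw n) (measurable_likelihoodRatio ρ n)
    (hsecond ▸ ENNReal.ofReal_ne_top) hA
  rw [← halt, hsecond, ENNReal.toReal_ofReal (inv_nonneg.2 hQ.le)] at htv
  have hcompl : {z | φ z = 1} = {z | φ z = 0}ᶜ := by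
    ext z
    simp only [Set.mem_ofPred_eq, Set.mem_compl_iff]
    omega
  rw [risk, hcompl, probReal_compl_eq_one_sub hA]
  linarith [le_abs_self ((nullLaw n).real {z | φ z = 0} - (altLaw ρ n).real {z | φ z = 0})]

lemma one_sub_sqrt_le_optRisk {ρ : ℝ} (hρ : |ρ| < 1) (n : ℕ) :
    1 - √((qPochhammer (ρ ^ 2) n)⁻¹ - 1) / 2 ≤ optRisk ρ n := by
  have : Nonempty {φ : Obs n → Fin 2 // Measurable φ} := ⟨⟨fun _ => 0, measurable_const⟩⟩
  exact le_ciInf fun φ => one_sub_sqrt_le_risk hρ φ.2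

lemma optRisk_le_one (ρ : ℝ) (n : ℕ) : optRisk ρ n ≤ 1 := by
  have hbdd : BddBelow (Set.range fun φ : {φ : Obs n → Fin 2 // Measurable φ} => risk ρ n φ) :=
    ⟨0, by rintro _ ⟨φ, rfl⟩; exact add_nonneg measureReal_nonneg measureReal_nonneg⟩
  refine (ciInf_le hbdd ⟨fun _ => 0, measurable_const⟩).trans ?_
  simp [risk]

lemma tendsto_qPochhammer {κ : Type*} {l : Filter κ} {q : κ → ℝ} (hq0 : ∀ k, 0 ≤ q k)
    (hlim : Tendsto q l (𝓝 0)) (n : κ → ℕ) :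
    Tendsto (fun k => qPochhammer (q k) (n k)) l (𝓝 1) := by
  have hcont : ContinuousAt (fun q : ℝ => 1 - q / (1 - q)) 0 := by fun_prop (disch := simp)
  have hlow := hcont.tendsto.comp hlim
  rw [zero_div, sub_zero] at hlow
  have hlt := hlim.eventually_lt_const one_pos
  refine tendsto_of_tendsto_of_tendsto_of_le_of_le' hlow tendsto_const_nhds ?_ ?_
  · filter_upwards [hlt] with k hk
    exact one_sub_div_le_qPochhammer (hq0 k) hk _
  · filter_upwards [hlt] with k hk
    exact qPochhammer_le_one (hq0 k) hk _

lemma tendsto_optRisk {κ : Type*} {l : Filter κ} {ρ : κ → ℝ} (n : κ → ℕ)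
    (hlim : Tendsto (fun k => ρ k ^ 2) l (𝓝 0)) :
    Tendsto (fun k => optRisk (ρ k) (n k)) l (𝓝 1) := by
  have hQ := tendsto_qPochhammer (fun k => sq_nonneg (ρ k)) hlim n
  have hlow : Tendsto (fun k => 1 - √((qPochhammer (ρ k ^ 2) (n k))⁻¹ - 1) / 2) l (𝓝 1) := by
    simpa using (((hQ.inv₀ one_ne_zero).sub_const 1).sqrt.div_const 2).const_sub 1
  refine tendsto_of_tendsto_of_tendsto_of_le_of_le' hlow tendsto_const_nhds ?_
    (.of_forall fun k => optRisk_le_one _ _)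
  filter_upwards [hlim.eventually_lt_const one_pos] with k hk
  exact one_sub_sqrt_le_optRisk ((sq_lt_one_iff_abs_lt_one _).1 hk) _

end Risk

end

end DatabaseDetection

theorem theorem2 (ρ : ℕ → ℝ) (n : ℕ → ℕ) (hρ : ∀ k, |ρ k| ≤ 1)
    (hlim : Tendsto (fun k => ρ k ^ 2) atTop (𝓝 0)) :
    Tendsto (fun k => DatabaseDetection.optRisk (ρ k) (n k)) atTop (𝓝 1) ∧
      ¬ DatabaseDetection.AdmissibleWeak ρ n := by
  have h := DatabaseDetection.tendsto_optRisk n hlim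
  refine ⟨h, ?_⟩
  rw [DatabaseDetection.AdmissibleWeak, h.limsup_eq]
  exact lt_irrefl 1
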